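/- Let $U:\mathbb{R}^d\to\mathbb{R}^d$ be globally Lipschitz and $\mu\in\mathbb{R}^d$. For $\eta,\tau,\sigma>0$ let $\theta_k\sim\rho_k=\mathcal N(\mu,\tau I)$ and $\varepsilon\sim\mathcal N(0,I)$ be independent, put $\theta_{k+1}=\theta_k-\eta U(\theta_k)+\sigma\varepsilon$, and let $\rho_{k+1}$ be the law of $\theta_{k+1}$. Let $$p(y\mid x)=(2\pi\sigma^2)^{-d/2}\exp\Big(-\tfrac{\|y-x+\eta U(x)\|^2}{2\sigma^2}\Big)$$ be the transition density, and define $\Delta S_{\rm tot}=\Delta S_{\rm bath}+\Delta S_{\rm sys}$, where $$\Delta S_{\rm bath}=\ln\frac{p(\theta_{k+1}\mid\theta_k)}{p(\theta_k\mid\theta_{k+1})},\qquad \Delta S_{\rm sys}=H(\rho_{k+1})-H(\rho_k),$$ and $H(\rho)=-\int\rho(x)\ln\rho(x)\,dx$ is the Shannon (differential) entropy of a law with Lebesgue density $\rho(x)$. Let $\phi_{\rm ST}(\theta)=\frac{\eta}{4}\|U(\theta)\|^2$. Then, for all $\eta,\tau,\sigma>0$, both laws $\rho_k,\rho_{k+1}$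 have Lebesgue densities with absolutely convergent entropy integrals, and $\Delta S_{\rm tot}$ is integrable. For every $\eta>0$ the limit $\lim_{\sigma\to0^+}\sigma^2\,\mathbb E[\Delta S_{\rm tot}]$ exists for every $\tau>0$, the limit of the result as $\tau\to0^+$ exists, and, for fixed $U$ and $\mu$, as $\eta\to0^+$, $$\lim_{\tau\to0}\Big(\lim_{\sigma^2\to0}\sigma^2\,\mathbb E[\Delta S_{\rm tot}]\Big)=8\eta\,\phi_{\rm ST}(\mu)+O(\eta^3).$$ -/

import Mathlib

open MeasureTheory ProbabilityTheory Filter Topology Asymptotics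

noncomputable section

namespace EntropyProduction

variable {d : ℕ}

/-- The isotropic Gaussian law `N(m, v I)` on `ℝ^d`. -/
def isoGaussian (m : EuclideanSpace ℝ (Fin d)) (v : ℝ) : Measure (EuclideanSpace ℝ (Fin d)) :=
  multivariateGaussian m (v • (1 : Matrix (Fin d) (Fin d) ℝ))

/-- The Lebesgue density at `x` of the isotropic Gaussian law `N(m, v I)` on `ℝ^d`, for `v > 0`. -/
def isoGaussianDensity (m : EuclideanSpace ℝ (Fin d)) (v : ℝ) (x : EuclideanSpace ℝ (Fin d)) : ℝ :=
  (2 * Real.pi * v) ^ (-(d : ℝ) / 2) * Real.exp (-‖x - m‖ ^ 2 / (2 * v))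

/-- The joint law of `(θ_k, θ_{k+1})`, where `θ_{k+1} = θ_k - η U(θ_k) + σ ε`, with
`θ_k ~ N(μ, τ I)` and `ε ~ N(0, I)` independent. -/
def jointLaw (U : EuclideanSpace ℝ (Fin d) → EuclideanSpace ℝ (Fin d))
    (μ : EuclideanSpace ℝ (Fin d)) (η τ σ : ℝ) :
    Measure (EuclideanSpace ℝ (Fin d) × EuclideanSpace ℝ (Fin d)) :=
  ((isoGaussian μ τ).prod (isoGaussian 0 1)).map
    (fun z => (z.1, z.1 - η • U z.1 + σ • z.2))

/-- The law of `θ_{k+1}`. -/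
def nextLaw (U : EuclideanSpace ℝ (Fin d) → EuclideanSpace ℝ (Fin d))
    (μ : EuclideanSpace ℝ (Fin d)) (η τ σ : ℝ) : Measure (EuclideanSpace ℝ (Fin d)) :=
  (jointLaw U μ η τ σ).map Prod.snd

/-- The transition density `p(y | x)` of the noisy update: the density at `y` of
`N(x - η U(x), σ² I)`. -/
def transitionDensity (U : EuclideanSpace ℝ (Fin d) → EuclideanSpace ℝ (Fin d)) (η σ : ℝ)
    (y x : EuclideanSpace ℝ (Fin d)) : ℝ :=
  isoGaussianDensity (x - η • U x) (σ ^ 2) y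

/-- The bath entropy production of the transition `x → y`: the log-ratio of the forward to the
backward transition density. -/
def bathEntropy (U : EuclideanSpace ℝ (Fin d) → EuclideanSpace ℝ (Fin d)) (η σ : ℝ)
    (x y : EuclideanSpace ℝ (Fin d)) : ℝ :=
  Real.log (transitionDensity U η σ y x / transitionDensity U η σ x y)

/-- The integrand `-p log p` of the Shannon entropy, `p` being the Lebesgue density of `ν`. -/
def entropyIntegrand (ν : Measure (EuclideanSpace ℝ (Fin d))) (x : EuclideanSpace ℝ (Fin d)) : ℝ :=
  Real.negMulLog (ν.rnDeriv volume x).toReal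

/-- The (differential) Shannon entropy `-∫ p log p` of an absolutely continuous law. -/
def shannonEntropy (ν : Measure (EuclideanSpace ℝ (Fin d))) : ℝ :=
  ∫ x, entropyIntegrand ν x

/-- The law `ν` has a well-defined, finite Shannon entropy. -/
def HasShannonEntropy (ν : Measure (EuclideanSpace ℝ (Fin d))) : Prop :=
  ν ≪ volume ∧ Integrable (entropyIntegrand ν) volume

/-- The system entropy change: the Shannon entropy of the law of `θ_{k+1}` minus that of the law
of `θ_k`. -/
def systemEntropy (U : EuclideanSpace ℝ (Fin d) → EuclideanSpace ℝ (Fin d))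
    (μ : EuclideanSpace ℝ (Fin d)) (η τ σ : ℝ) : ℝ :=
  shannonEntropy (nextLaw U μ η τ σ) - shannonEntropy (isoGaussian μ τ)

/-- The total entropy production of the transition `z.1 → z.2`. -/
def totalEntropy (U : EuclideanSpace ℝ (Fin d) → EuclideanSpace ℝ (Fin d))
    (μ : EuclideanSpace ℝ (Fin d)) (η τ σ : ℝ)
    (z : EuclideanSpace ℝ (Fin d) × EuclideanSpace ℝ (Fin d)) : ℝ :=
  bathEntropy U η σ z.1 z.2 + systemEntropy U μ η τ σ

/-- The stochastic entropy potential. -/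
def phiST (U : EuclideanSpace ℝ (Fin d) → EuclideanSpace ℝ (Fin d)) (η : ℝ)
    (x : EuclideanSpace ℝ (Fin d)) : ℝ :=
  η / 4 * ‖U x‖ ^ 2

end EntropyProduction

end

noncomputable section

namespace EntropyProduction

open scoped RealInnerProductSpace

variable {d : ℕ}

/-! In the bath term the normalising constants cancel. Along y = x - ηU(x) + σe, multiplying by σ²
leaves (‖η(U(x) + U(y)) - σe‖² - ‖σe‖²)/2, which is continuous up to σ = 0 (`bathEntropy_update`).
Linear growth of U and Gaussian second moments dominate it, so as σ → 0 its mean tends to the N(μ,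
τI)-average of ‖η(U(x) + U(x - ηU(x)))‖²/2.

The system term drops out. The density of θ_{k+1} is a mixture of Gaussians with peak (2πσ²)^(-d/2),
so its entropy is at least (d/2) log(2πσ²); Gibbs' inequality against N(0, I) bounds it above
uniformly for σ ≤ 1 (`hasShannonEntropy_of_bounded_density`). Hence σ² times the entropy change
vanishes.

As τ → 0 the average concentrates at μ. Replacing U(μ - ηU(μ)) by U(μ) changes the norm by O(η),
giving 2η²‖U(μ)‖² + O(η³), whose leading term is 8ηφ_ST(μ). -/

/-! ### Isotropic Gaussian laws and their densities -/

instance isGaussian_isoGaussian (m : EuclideanSpace ℝ (Fin d)) (v : ℝ) :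
    IsGaussian (isoGaussian m v) :=
  isGaussian_multivariateGaussian

lemma charFun_isoGaussian (m : EuclideanSpace ℝ (Fin d)) {v : ℝ} (hv : 0 ≤ v)
    (t : EuclideanSpace ℝ (Fin d)) :
    charFun (isoGaussian m v) t =
      Complex.exp (⟪t, m⟫ * Complex.I - v * ‖t‖ ^ 2 / 2) := by
  rw [isoGaussian, charFun_multivariateGaussian (Matrix.PosSemidef.one.smul hv)]
  congr 3
  have : t ⬝ᵥ (v • (1 : Matrix (Fin d) (Fin d) ℝ)).mulVec t = v * ‖t‖ ^ 2 := by
    rw [Matrix.smul_mulVec, Matrix.one_mulVec, dotProduct_smul, EuclideanSpace.real_norm_sq_eq]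
    simp [dotProduct, sq]
  rw [this]
  push_cast
  rfl

/-- Moves the parameters from the measure into the integrand, so that limits in the variance become
dominated convergence under one fixed law. -/
lemma isoGaussian_eq_map (m : EuclideanSpace ℝ (Fin d)) {v : ℝ} (hv : 0 ≤ v) :
    isoGaussian m v = (isoGaussian 0 1).map (fun z => m + √v • z) := by
  have : (isoGaussian (0 : EuclideanSpace ℝ (Fin d)) 1).map (fun z => m + √v • z)
      = ((isoGaussian 0 1).map (fun z => √v • z)).map (fun z => m + z) := by
    rw [Measure.map_map (by fun_prop) (by fun_prop)]
    rfl
  rw [this]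
  have : IsProbabilityMeasure ((isoGaussian (0 : EuclideanSpace ℝ (Fin d)) 1).map
      (fun z => √v • z)) := Measure.isProbabilityMeasure_map (by fun_prop)
  have : IsProbabilityMeasure (((isoGaussian (0 : EuclideanSpace ℝ (Fin d)) 1).map
      (fun z => √v • z)).map (fun z => m + z)) := Measure.isProbabilityMeasure_map (by fun_prop)
  refine Measure.ext_of_charFun (funext fun t => ?_)
  rw [charFun_map_const_add, charFun_map_smul, charFun_isoGaussian _ hv,
    charFun_isoGaussian _ zero_le_one, ← Complex.exp_add, norm_smul, real_inner_comm]
  congr 1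
  have : ((|√v| : ℝ) : ℂ) ^ 2 = v := by
    rw [← Complex.ofReal_pow, sq_abs, Real.sq_sqrt hv]
  simp only [Real.norm_eq_abs, Complex.ofReal_mul, mul_pow, this, inner_zero_right]
  push_cast
  ring

lemma isoGaussianDensity_pos (m : EuclideanSpace ℝ (Fin d)) {v : ℝ} (hv : 0 < v)
    (x : EuclideanSpace ℝ (Fin d)) : 0 < isoGaussianDensity m v x := by
  unfold isoGaussianDensity
  positivity

lemma isoGaussianDensity_le (m : EuclideanSpace ℝ (Fin d)) {v : ℝ} (hv : 0 < v)
    (x : EuclideanSpace ℝ (Fin d)) :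
    isoGaussianDensity m v x ≤ (2 * Real.pi * v) ^ (-(d : ℝ) / 2) := by
  unfold isoGaussianDensity
  refine mul_le_of_le_one_right (by positivity) (Real.exp_le_one_iff.2 ?_)
  rw [neg_div]
  exact neg_nonpos.2 (by positivity)

lemma log_isoGaussianDensity (m : EuclideanSpace ℝ (Fin d)) {v : ℝ} (hv : 0 < v)
    (x : EuclideanSpace ℝ (Fin d)) :
    Real.log (isoGaussianDensity m v x) =
      -(d : ℝ) / 2 * Real.log (2 * Real.pi * v) - ‖x - m‖ ^ 2 / (2 * v) := by
  unfold isoGaussianDensity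
  rw [Real.log_mul (by positivity) (Real.exp_pos _).ne', Real.log_exp,
    Real.log_rpow (by positivity)]
  ring

lemma continuous_isoGaussianDensity (m : EuclideanSpace ℝ (Fin d)) (v : ℝ) :
    Continuous (isoGaussianDensity m v) := by
  unfold isoGaussianDensity
  fun_prop

lemma integral_isoGaussianDensity (m : EuclideanSpace ℝ (Fin d)) {v : ℝ} (hv : 0 < v) :
    ∫ x, isoGaussianDensity m v x = 1 := by
  have h := integral_sub_right_eq_self (μ := volume)
    (fun x : EuclideanSpace ℝ (Fin d) =>
      (2 * Real.pi * v) ^ (-(d : ℝ) / 2) * Real.exp (-(2 * v)⁻¹ * ‖x‖ ^ 2)) m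
  have h' : isoGaussianDensity m v = fun x =>
      (2 * Real.pi * v) ^ (-(d : ℝ) / 2) * Real.exp (-(2 * v)⁻¹ * ‖x - m‖ ^ 2) := by
    ext x
    unfold isoGaussianDensity
    congr 2
    ring
  rw [h', h, integral_const_mul, GaussianFourier.integral_rexp_neg_mul_sq_norm (by positivity),
    finrank_euclideanSpace_fin, neg_div, Real.rpow_neg (by positivity),
    show Real.pi / (2 * v)⁻¹ = 2 * Real.pi * v by field_simp]
  exact inv_mul_cancel₀ (by positivity)

lemma integrable_isoGaussianDensity (m : EuclideanSpace ℝ (Fin d)) {v : ℝ} (hv : 0 < v) :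
    Integrable (isoGaussianDensity m v) := by
  by_contra h
  have := integral_isoGaussianDensity m hv
  -- The Bochner integral of a nonintegrable function is 0 by convention, against the total mass 1.
  rw [integral_undef h] at this
  exact zero_ne_one this

/-- Translation by m reduces this to the Fourier transform of a centred Gaussian; uniqueness of
characteristic functions then identifies the density. -/
lemma charFun_withDensity_isoGaussianDensity (m : EuclideanSpace ℝ (Fin d)) {v : ℝ} (hv : 0 < v)
    (t : EuclideanSpace ℝ (Fin d)) :
    charFun (volume.withDensity fun x => ENNReal.ofReal (isoGaussianDensity m v x)) t =
      Complex.exp (⟪t, m⟫ * Complex.I - v * ‖t‖ ^ 2 / 2) := by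
  have hmeas : Measurable fun x => ENNReal.ofReal (isoGaussianDensity m v x) :=
    (continuous_isoGaussianDensity m v).measurable.ennreal_ofReal
  rw [charFun_apply, integral_withDensity_eq_integral_toReal_smul hmeas (by simp)]
  have key : ∀ x : EuclideanSpace ℝ (Fin d),
      (ENNReal.ofReal (isoGaussianDensity m v x)).toReal • Complex.exp (⟪x, t⟫ * Complex.I) =
        ((2 * Real.pi * v : ℝ) : ℂ) ^ (-(d : ℂ) / 2) * Complex.exp (⟪t, m⟫ * Complex.I) *
          Complex.exp (-((2 * v)⁻¹ : ℝ) * ‖x - m‖ ^ 2 + Complex.I * ⟪t, x - m⟫) := by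
    intro x
    rw [ENNReal.toReal_ofReal (isoGaussianDensity_pos m hv x).le, isoGaussianDensity,
      Complex.real_smul, Complex.ofReal_mul, Complex.ofReal_cpow (by positivity),
      Complex.ofReal_exp, mul_assoc, ← Complex.exp_add,
      mul_assoc (_ ^ _ : ℂ), ← Complex.exp_add]
    push_cast
    congr 2
    rw [inner_sub_right, real_inner_comm]
    push_cast
    ring
  simp_rw [key]
  rw [integral_const_mul, integral_sub_right_eq_self (μ := volume)
    (fun x : EuclideanSpace ℝ (Fin d) =>
      Complex.exp (-((2 * v)⁻¹ : ℝ) * ‖x‖ ^ 2 + Complex.I * ⟪t, x⟫)) m,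
    GaussianFourier.integral_cexp_neg_mul_sq_norm_add
      (by rw [Complex.ofReal_re]; positivity), finrank_euclideanSpace_fin]
  have hbase : (Real.pi : ℂ) / ((2 * v)⁻¹ : ℝ) = ((2 * Real.pi * v : ℝ) : ℂ) := by
    push_cast
    have : (v : ℂ) ≠ 0 := by exact_mod_cast hv.ne'
    field_simp
  have h0 : ((2 * Real.pi * v : ℝ) : ℂ) ≠ 0 := by
    rw [Complex.ofReal_ne_zero]
    positivity
  rw [hbase, neg_div, Complex.cpow_neg]
  have hpow : ((2 * Real.pi * v : ℝ) : ℂ) ^ ((d : ℂ) / 2) ≠ 0 := by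
    rw [Ne, Complex.cpow_eq_zero_iff]
    exact fun h => h0 h.1
  rw [mul_mul_mul_comm, inv_mul_cancel₀ hpow, one_mul, ← Complex.exp_add]
  congr 1
  push_cast
  have : (v : ℂ) ≠ 0 := by exact_mod_cast hv.ne'
  rw [Complex.I_sq]
  field_simp
  ring

/-- The Gaussian law `N(m, v I)` has Lebesgue density `isoGaussianDensity m v`. -/
lemma isoGaussian_eq_withDensity (m : EuclideanSpace ℝ (Fin d)) {v : ℝ} (hv : 0 < v) :
    isoGaussian m v =
      volume.withDensity fun x => ENNReal.ofReal (isoGaussianDensity m v x) := by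
  have := isFiniteMeasure_withDensity_ofReal (integrable_isoGaussianDensity m hv).2
  refine Measure.ext_of_charFun (funext fun t => ?_)
  rw [charFun_isoGaussian m hv.le, charFun_withDensity_isoGaussianDensity m hv]

/-! ### Two-sided entropy bounds -/

lemma neg_log_mul_le_negMulLog {p C : ℝ} (hp : 0 ≤ p) (hpC : p ≤ C) :
    p * -Real.log C ≤ Real.negMulLog p := by
  rcases hp.eq_or_lt with rfl | hp
  · simp
  · have := mul_le_mul_of_nonneg_left (Real.log_le_log hp hpC) hp.le
    rw [Real.negMulLog]
    linarith

/-- The pointwise form of Gibbs' inequality. -/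
lemma negMulLog_le_of_pos {p q : ℝ} (hp : 0 ≤ p) (hq : 0 < q) :
    Real.negMulLog p ≤ p * -Real.log q + (q - p) := by
  rcases hp.eq_or_lt with rfl | hp
  · simpa using hq.le
  · have h := mul_le_mul_of_nonneg_left (Real.log_le_sub_one_of_pos (div_pos hq hp)) hp.le
    rw [Real.log_div hq.ne' hp.ne', mul_sub, mul_sub, mul_div_cancel₀ _ hp.ne'] at h
    rw [Real.negMulLog]
    linarith

/-- A law with bounded density and finite second moment has a finite Shannon entropy, bounded
below through the bound on the density and above through Gibbs' inequality. -/
lemma hasShannonEntropy_of_bounded_density {ν : Measure (EuclideanSpace ℝ (Fin d))}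
    [IsProbabilityMeasure ν] {f : EuclideanSpace ℝ (Fin d) → ENNReal} (hf : Measurable f)
    (hν : ν = volume.withDensity f) {C : ℝ} (hC : 0 ≤ C) (hfC : ∀ x, f x ≤ ENNReal.ofReal C)
    (h2 : Integrable (fun x => ‖x‖ ^ 2) ν) :
    HasShannonEntropy ν ∧ -Real.log C ≤ shannonEntropy ν ∧
      shannonEntropy ν ≤ d / 2 * Real.log (2 * Real.pi) + (∫ x, ‖x‖ ^ 2 ∂ν) / 2 := by
  have hac : ν ≪ volume := hν ▸ withDensity_absolutelyContinuous _ _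
  set p : EuclideanSpace ℝ (Fin d) → ℝ := fun x => (ν.rnDeriv volume x).toReal with hp
  have hpm : Measurable p := (Measure.measurable_rnDeriv _ _).ennreal_toReal
  have hp0 : ∀ x, 0 ≤ p x := fun x => ENNReal.toReal_nonneg
  have hpC : ∀ᵐ x, p x ≤ C := by
    have : ν.rnDeriv volume =ᵐ[volume] f := by
      rw [hν]
      exact Measure.rnDeriv_withDensity _ hf
    filter_upwards [this] with x hx
    exact ENNReal.toReal_le_of_le_ofReal hC (hx ▸ hfC x)
  -- With a Gaussian reference density, -log q is quadratic, so the second moment of ν controls the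
  -- cross entropy.
  set q : EuclideanSpace ℝ (Fin d) → ℝ := isoGaussianDensity 0 1 with hq
  have hlogq : ∀ x, -Real.log (q x) = d / 2 * Real.log (2 * Real.pi) + ‖x‖ ^ 2 / 2 := by
    intro x
    rw [hq, log_isoGaussianDensity 0 one_pos]
    simp only [mul_one, sub_zero]
    ring
  have hlow : Integrable (fun x => p x * -Real.log C) :=
    (Measure.integrable_toReal_rnDeriv).mul_const _
  have hlogν : Integrable (fun x => -Real.log (q x)) ν := by
    simp_rw [hlogq]
    exact (integrable_const _).add (h2.div_const _)
  have hmid : Integrable (fun x => p x * -Real.log (q x)) :=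
    (integrable_rnDeriv_smul_iff hac).2 hlogν
  have hqp : Integrable (fun x => q x - p x) :=
    (integrable_isoGaussianDensity 0 one_pos).sub Measure.integrable_toReal_rnDeriv
  have hup : Integrable (fun x => p x * -Real.log (q x) + (q x - p x)) := hmid.add hqp
  have hle₁ : ∀ᵐ x, p x * -Real.log C ≤ entropyIntegrand ν x := by
    filter_upwards [hpC] with x hx
    exact neg_log_mul_le_negMulLog (hp0 x) hx
  have hle₂ : ∀ x, entropyIntegrand ν x ≤ p x * -Real.log (q x) + (q x - p x) := fun x =>
    negMulLog_le_of_pos (hp0 x) (isoGaussianDensity_pos 0 one_pos x)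
  have hint : Integrable (entropyIntegrand ν) :=
    integrable_of_le_of_le (Real.continuous_negMulLog.measurable.comp hpm).aestronglyMeasurable
      hle₁ (ae_of_all _ hle₂) hlow hup
  have hp1 : ∫ x, p x = 1 := by
    rw [Measure.integral_toReal_rnDeriv hac, probReal_univ]
  refine ⟨⟨hac, hint⟩, ?_, ?_⟩
  · have := integral_mono_ae hlow hint hle₁
    rwa [integral_mul_const, hp1, one_mul] at this
  · refine (integral_mono hint hup hle₂).trans_eq ?_
    have hmid' : ∫ x, p x * -Real.log (q x) = ∫ x, -Real.log (q x) ∂ν :=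
      integral_rnDeriv_smul hac
    rw [integral_add hmid hqp,
      integral_sub (integrable_isoGaussianDensity 0 one_pos) Measure.integrable_toReal_rnDeriv,
      hp1, integral_isoGaussianDensity 0 one_pos, hmid']
    simp_rw [hlogq]
    rw [integral_add (integrable_const _) (h2.div_const _), integral_div]
    simp

lemma integrable_sq_norm_isoGaussian (m : EuclideanSpace ℝ (Fin d)) (v : ℝ) :
    Integrable (fun x => ‖x‖ ^ 2) (isoGaussian m v) :=
  (memLp_two_iff_integrable_sq_norm aestronglyMeasurable_id).1 IsGaussian.memLp_two_id

lemma hasShannonEntropy_isoGaussian (m : EuclideanSpace ℝ (Fin d)) {v : ℝ} (hv : 0 < v) :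
    HasShannonEntropy (isoGaussian m v) :=
  (hasShannonEntropy_of_bounded_density
    (continuous_isoGaussianDensity m v).measurable.ennreal_ofReal
    (isoGaussian_eq_withDensity m hv) (C := (2 * Real.pi * v) ^ (-(d : ℝ) / 2)) (by positivity)
    (fun x => ENNReal.ofReal_le_ofReal (isoGaussianDensity_le m hv x))
    (integrable_sq_norm_isoGaussian m v)).1

/-! ### The law of the updated variable -/

variable {U : EuclideanSpace ℝ (Fin d) → EuclideanSpace ℝ (Fin d)}

lemma continuous_transitionDensity (hU : Continuous U) (η σ : ℝ) :
    Continuous fun z : EuclideanSpace ℝ (Fin d) × EuclideanSpace ℝ (Fin d) =>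
      transitionDensity U η σ z.1 z.2 := by
  unfold transitionDensity isoGaussianDensity
  fun_prop

lemma nextLaw_eq_map (hU : Continuous U) (μ : EuclideanSpace ℝ (Fin d)) (η τ σ : ℝ) :
    nextLaw U μ η τ σ = ((isoGaussian μ τ).prod (isoGaussian 0 1)).map
      (fun z => z.1 - η • U z.1 + σ • z.2) := by
  have := hU.measurable
  rw [nextLaw, jointLaw, Measure.map_map measurable_snd (by fun_prop)]
  rfl

/-- Given θ_k = x, the next state has law N(x - ηU(x), σ²I); Tonelli turns the mixture of these laws
into a mixture of densities. -/
lemma nextLaw_eq_withDensity (hU : Continuous U) (μ : EuclideanSpace ℝ (Fin d)) (η τ : ℝ) {σ : ℝ}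
    (hσ : 0 < σ) :
    nextLaw U μ η τ σ = volume.withDensity fun y =>
      ∫⁻ x, ENNReal.ofReal (transitionDensity U η σ y x) ∂(isoGaussian μ τ) := by
  have hUm := hU.measurable
  have hmap : Measurable fun z : EuclideanSpace ℝ (Fin d) × EuclideanSpace ℝ (Fin d) =>
      z.1 - η • U z.1 + σ • z.2 := by fun_prop
  have hdens := (continuous_transitionDensity hU η σ).measurable.ennreal_ofReal
  ext A hA
  rw [nextLaw_eq_map hU, Measure.map_apply hmap hA, Measure.prod_apply (hmap hA),
    withDensity_apply _ hA, lintegral_lintegral_swap hdens.aemeasurable]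
  refine lintegral_congr fun x => ?_
  have hx : isoGaussian (x - η • U x) (σ ^ 2) =
      (isoGaussian 0 1).map (fun z => x - η • U x + σ • z) := by
    rw [isoGaussian_eq_map _ (sq_nonneg σ), Real.sqrt_sq hσ.le]
  rw [← withDensity_apply _ hA]
  change isoGaussian 0 1 ((fun z => x - η • U x + σ • z) ⁻¹' A) =
    volume.withDensity
      (fun y => ENNReal.ofReal (isoGaussianDensity (x - η • U x) (σ ^ 2) y)) A
  rw [← isoGaussian_eq_withDensity _ (pow_pos hσ 2), hx, Measure.map_apply (by fun_prop) hA]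

/-! ### Growth bounds and the bath entropy -/

variable {K : NNReal}

lemma norm_le_of_lipschitzWith (hU : LipschitzWith K U) (x : EuclideanSpace ℝ (Fin d)) :
    ‖U x‖ ≤ ‖U 0‖ + K * ‖x‖ := by
  have h := hU.norm_sub_le x 0
  rw [sub_zero] at h
  have := norm_le_norm_add_norm_sub' (U x) (U 0)
  linarith

/-- Linear growth of one update step, and of the sum of the two drifts met along it. -/
lemma exists_linear_growth (hU : LipschitzWith K U) {η : ℝ} (hη : 0 ≤ η) :
    ∃ a b : ℝ, 0 ≤ a ∧ 0 ≤ b ∧ ∀ x e : EuclideanSpace ℝ (Fin d),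
      ‖x - η • U x + e‖ ≤ a + b * (‖x‖ + ‖e‖) ∧
      ‖U x + U (x - η • U x + e)‖ ≤ a + b * (‖x‖ + ‖e‖) := by
  set c := ‖U 0‖
  have hc : 0 ≤ c := norm_nonneg _
  have hK : (0 : ℝ) ≤ K := K.coe_nonneg
  -- Each witness adds the constants of the two separate bounds, so one pair serves both.
  refine ⟨η * c + (c + c + K * (η * c)), (1 + η * K) + (K + K * (1 + η * K)),
    by positivity, by positivity, fun x e => ?_⟩
  have hUx : ‖U x‖ ≤ c + K * ‖x‖ := norm_le_of_lipschitzWith hU x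
  have hx := norm_nonneg x
  have he := norm_nonneg e
  have hy : ‖x - η • U x + e‖ ≤ η * c + (1 + η * K) * (‖x‖ + ‖e‖) := by
    calc ‖x - η • U x + e‖ ≤ ‖x‖ + η * ‖U x‖ + ‖e‖ := by
          refine (norm_add_le _ _).trans (add_le_add_left ((norm_sub_le _ _).trans_eq ?_) _)
          rw [norm_smul, Real.norm_of_nonneg hη]
      _ ≤ ‖x‖ + η * (c + K * ‖x‖) + ‖e‖ := by gcongr
      _ ≤ _ := by
          have : 0 ≤ η * K * ‖e‖ := by positivity
          linarith
  have hUy : ‖U (x - η • U x + e)‖ ≤ c + K * (η * c + (1 + η * K) * (‖x‖ + ‖e‖)) :=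
    (norm_le_of_lipschitzWith hU _).trans (by gcongr)
  constructor
  · have : 0 ≤ c + c + K * (η * c) + (K + K * (1 + η * K)) * (‖x‖ + ‖e‖) := by positivity
    linarith
  · have h1 : 0 ≤ η * c + (1 + η * K) * (‖x‖ + ‖e‖) := by positivity
    have h2 : 0 ≤ K * ‖e‖ := by positivity
    have := norm_add_le (U x) (U (x - η • U x + e))
    linarith

lemma bathEntropy_eq (η : ℝ) {σ : ℝ} (hσ : 0 < σ) (x y : EuclideanSpace ℝ (Fin d)) :
    bathEntropy U η σ x y =
      (‖x - (y - η • U y)‖ ^ 2 - ‖y - (x - η • U x)‖ ^ 2) / (2 * σ ^ 2) := by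
  have hσ2 := pow_pos hσ 2
  unfold bathEntropy transitionDensity
  rw [Real.log_div (isoGaussianDensity_pos _ hσ2 _).ne' (isoGaussianDensity_pos _ hσ2 _).ne',
    log_isoGaussianDensity _ hσ2, log_isoGaussianDensity _ hσ2]
  ring

/-- The bath entropy production, scaled by `σ²`, of the update of `z.1` driven by the noise
`z.2`. -/
def scaledBathEntropy (U : EuclideanSpace ℝ (Fin d) → EuclideanSpace ℝ (Fin d)) (η σ : ℝ)
    (z : EuclideanSpace ℝ (Fin d) × EuclideanSpace ℝ (Fin d)) : ℝ :=
  (‖η • (U z.1 + U (z.1 - η • U z.1 + σ • z.2)) - σ • z.2‖ ^ 2 - ‖σ • z.2‖ ^ 2) / 2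

/-- The forward residual is exactly σe, and the backward one is η(U(x) + U(y)) - σe; the only
singularity at σ = 0 is the prefactor. -/
lemma bathEntropy_update (η : ℝ) {σ : ℝ} (hσ : 0 < σ)
    (z : EuclideanSpace ℝ (Fin d) × EuclideanSpace ℝ (Fin d)) :
    bathEntropy U η σ z.1 (z.1 - η • U z.1 + σ • z.2) =
      (σ ^ 2)⁻¹ * scaledBathEntropy U η σ z := by
  rw [bathEntropy_eq η hσ, scaledBathEntropy, add_sub_cancel_left]
  have : z.1 - (z.1 - η • U z.1 + σ • z.2 - η • U (z.1 - η • U z.1 + σ • z.2)) =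
      η • (U z.1 + U (z.1 - η • U z.1 + σ • z.2)) - σ • z.2 := by
    rw [smul_add]
    abel
  rw [this]
  field_simp

lemma integrable_linear_growth_sq (μ : EuclideanSpace ℝ (Fin d)) (τ a b : ℝ) :
    Integrable (fun z : EuclideanSpace ℝ (Fin d) × EuclideanSpace ℝ (Fin d) =>
      (a + b * (‖z.1‖ + ‖z.2‖)) ^ 2) ((isoGaussian μ τ).prod (isoGaussian 0 1)) := by
  have h1 : MemLp (fun z : EuclideanSpace ℝ (Fin d) × EuclideanSpace ℝ (Fin d) => z.1) 2
      ((isoGaussian μ τ).prod (isoGaussian 0 1)) :=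
    (IsGaussian.memLp_two_id (μ := isoGaussian μ τ)).comp_fst _
  have h2 : MemLp (fun z : EuclideanSpace ℝ (Fin d) × EuclideanSpace ℝ (Fin d) => z.2) 2
      ((isoGaussian μ τ).prod (isoGaussian 0 1)) :=
    (IsGaussian.memLp_two_id
      (μ := isoGaussian (0 : EuclideanSpace ℝ (Fin d)) 1)).comp_snd _
  exact ((memLp_const a).add ((h1.norm.add h2.norm).const_mul b)).integrable_sq

lemma norm_smul_le_of_mem_Ioc {σ : ℝ} (hσ : σ ∈ Set.Ioc (0 : ℝ) 1)
    (e : EuclideanSpace ℝ (Fin d)) : ‖σ • e‖ ≤ ‖e‖ := by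
  rw [norm_smul, Real.norm_of_nonneg hσ.1.le]
  exact mul_le_of_le_one_left (norm_nonneg _) hσ.2

lemma continuous_scaledBathEntropy (hU : Continuous U) (η : ℝ) :
    Continuous fun w : ℝ × (EuclideanSpace ℝ (Fin d) × EuclideanSpace ℝ (Fin d)) =>
      scaledBathEntropy U η w.1 w.2 := by
  unfold scaledBathEntropy
  fun_prop

/-- Both squares in the half-difference are at most the right-hand side. Leaving `σ • z.2` intact
serves both integrability at any σ and domination uniform over σ ≤ 1. -/
lemma abs_scaledBathEntropy_le {η a b : ℝ} (hη : 0 ≤ η) (ha : 0 ≤ a) (hb : 0 ≤ b)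
    (h : ∀ x e : EuclideanSpace ℝ (Fin d), ‖U x + U (x - η • U x + e)‖ ≤ a + b * (‖x‖ + ‖e‖))
    (σ : ℝ) (z : EuclideanSpace ℝ (Fin d) × EuclideanSpace ℝ (Fin d)) :
    |scaledBathEntropy U η σ z| ≤ (η * a + (η * b + 1) * (‖z.1‖ + ‖σ • z.2‖)) ^ 2 := by
  have h1 : ‖η • (U z.1 + U (z.1 - η • U z.1 + σ • z.2)) - σ • z.2‖ ≤
      η * a + (η * b + 1) * (‖z.1‖ + ‖σ • z.2‖) := by
    refine (norm_sub_le _ _).trans ?_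
    rw [norm_smul η, Real.norm_of_nonneg hη]
    have := mul_le_mul_of_nonneg_left (h z.1 (σ • z.2)) hη
    have := norm_nonneg z.1
    linarith
  have h2 : ‖σ • z.2‖ ≤ η * a + (η * b + 1) * (‖z.1‖ + ‖σ • z.2‖) := by
    have : 0 ≤ η * a + η * b * (‖z.1‖ + ‖σ • z.2‖) := by positivity
    have := norm_nonneg z.1
    linarith
  have h3 := pow_le_pow_left₀ (norm_nonneg _) h1 2
  have h4 := pow_le_pow_left₀ (norm_nonneg _) h2 2
  have h5 := sq_nonneg ‖η • (U z.1 + U (z.1 - η • U z.1 + σ • z.2)) - σ • z.2‖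
  have h6 := sq_nonneg ‖σ • z.2‖
  rw [scaledBathEntropy, abs_le]
  constructor <;> linarith

lemma integrable_scaledBathEntropy (hU : LipschitzWith K U) (μ : EuclideanSpace ℝ (Fin d))
    {η : ℝ} (hη : 0 ≤ η) (τ σ : ℝ) :
    Integrable (scaledBathEntropy U η σ) ((isoGaussian μ τ).prod (isoGaussian 0 1)) := by
  obtain ⟨a, b, ha, hb, h⟩ := exists_linear_growth hU hη
  refine (integrable_linear_growth_sq μ τ (η * a) ((η * b + 1) * (1 + |σ|))).mono'
    ((continuous_scaledBathEntropy hU.continuous η).comp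
      (Continuous.prodMk_right σ)).aestronglyMeasurable (ae_of_all _ fun z => ?_)
  refine (abs_scaledBathEntropy_le hη ha hb (fun x e => (h x e).2) σ z).trans ?_
  have h1 : ‖z.1‖ + ‖σ • z.2‖ ≤ (1 + |σ|) * (‖z.1‖ + ‖z.2‖) := by
    rw [norm_smul, Real.norm_eq_abs]
    have : 0 ≤ |σ| * ‖z.1‖ := by positivity
    have := norm_nonneg z.2
    linarith
  rw [mul_assoc]
  gcongr

lemma measurable_update (hU : Continuous U) (η σ : ℝ) :
    Measurable fun z : EuclideanSpace ℝ (Fin d) × EuclideanSpace ℝ (Fin d) =>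
      (z.1, z.1 - η • U z.1 + σ • z.2) := by
  have := hU.measurable
  fun_prop

lemma measurable_totalEntropy (hU : Continuous U) (μ : EuclideanSpace ℝ (Fin d)) (η τ σ : ℝ) :
    Measurable (totalEntropy U μ η τ σ) := by
  have h := (continuous_transitionDensity hU η σ).measurable
  exact ((h.comp measurable_swap).div h).log.add_const _

lemma totalEntropy_update (μ : EuclideanSpace ℝ (Fin d)) (η τ : ℝ) {σ : ℝ} (hσ : 0 < σ)
    (z : EuclideanSpace ℝ (Fin d) × EuclideanSpace ℝ (Fin d)) :
    totalEntropy U μ η τ σ (z.1, z.1 - η • U z.1 + σ • z.2) =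
      (σ ^ 2)⁻¹ * scaledBathEntropy U η σ z + systemEntropy U μ η τ σ := by
  rw [← bathEntropy_update η hσ]
  rfl

lemma integrable_totalEntropy (hU : LipschitzWith K U) (μ : EuclideanSpace ℝ (Fin d))
    {η : ℝ} (hη : 0 ≤ η) (τ : ℝ) {σ : ℝ} (hσ : 0 < σ) :
    Integrable (totalEntropy U μ η τ σ) (jointLaw U μ η τ σ) := by
  rw [jointLaw, integrable_map_measure
    (measurable_totalEntropy hU.continuous μ η τ σ).aestronglyMeasurable
    (measurable_update hU.continuous η σ).aemeasurable]
  simp only [Function.comp_def, totalEntropy_update μ η τ hσ]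
  exact ((integrable_scaledBathEntropy hU μ hη τ σ).const_mul _).add (integrable_const _)

lemma sq_mul_integral_totalEntropy (hU : LipschitzWith K U) (μ : EuclideanSpace ℝ (Fin d))
    {η : ℝ} (hη : 0 ≤ η) (τ : ℝ) {σ : ℝ} (hσ : 0 < σ) :
    σ ^ 2 * ∫ z, totalEntropy U μ η τ σ z ∂(jointLaw U μ η τ σ) =
      (∫ z, scaledBathEntropy U η σ z ∂((isoGaussian μ τ).prod (isoGaussian 0 1))) +
        σ ^ 2 * systemEntropy U μ η τ σ := by
  rw [jointLaw, integral_map (measurable_update hU.continuous η σ).aemeasurable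
    (measurable_totalEntropy hU.continuous μ η τ σ).aestronglyMeasurable]
  simp only [totalEntropy_update μ η τ hσ]
  rw [integral_add ((integrable_scaledBathEntropy hU μ hη τ σ).const_mul _) (integrable_const _),
    integral_const_mul, integral_const, probReal_univ, one_smul, mul_add,
    mul_inv_cancel_left₀ (pow_pos hσ 2).ne']

/-! ### The system entropy is negligible at scale σ⁻² -/

/-- The entropy of the law of the updated variable, with bounds explicit in the noise level. -/
lemma hasShannonEntropy_nextLaw (hU : LipschitzWith K U) (μ : EuclideanSpace ℝ (Fin d))
    {η : ℝ} (hη : 0 ≤ η) (τ : ℝ) :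
    ∃ M : ℝ, ∀ σ : ℝ, 0 < σ → HasShannonEntropy (nextLaw U μ η τ σ) ∧
      d / 2 * Real.log (2 * Real.pi * σ ^ 2) ≤ shannonEntropy (nextLaw U μ η τ σ) ∧
      (σ ≤ 1 → shannonEntropy (nextLaw U μ η τ σ) ≤ M) := by
  obtain ⟨a, b, ha, hb, h⟩ := exists_linear_growth hU hη
  refine ⟨d / 2 * Real.log (2 * Real.pi) +
    (∫ z : EuclideanSpace ℝ (Fin d) × EuclideanSpace ℝ (Fin d), (a + b * (‖z.1‖ + ‖z.2‖)) ^ 2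
      ∂((isoGaussian μ τ).prod (isoGaussian 0 1))) / 2, fun σ hσ => ?_⟩
  have hUc := hU.continuous
  have hmap : Measurable fun z : EuclideanSpace ℝ (Fin d) × EuclideanSpace ℝ (Fin d) =>
      z.1 - η • U z.1 + σ • z.2 := (measurable_update hUc η σ).snd
  have hprob : IsProbabilityMeasure (nextLaw U μ η τ σ) := by
    rw [nextLaw_eq_map hUc]
    exact Measure.isProbabilityMeasure_map hmap.aemeasurable
  have hsq : AEStronglyMeasurable (fun x : EuclideanSpace ℝ (Fin d) => ‖x‖ ^ 2)
      (((isoGaussian μ τ).prod (isoGaussian 0 1)).map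
        (fun z => z.1 - η • U z.1 + σ • z.2)) := by fun_prop
  have hle : ∀ z : EuclideanSpace ℝ (Fin d) × EuclideanSpace ℝ (Fin d),
      ‖z.1 - η • U z.1 + σ • z.2‖ ^ 2 ≤ (a + b * (‖z.1‖ + ‖σ • z.2‖)) ^ 2 := fun z =>
    pow_le_pow_left₀ (norm_nonneg _) (h z.1 (σ • z.2)).1 2
  have hint : Integrable (fun z : EuclideanSpace ℝ (Fin d) × EuclideanSpace ℝ (Fin d) =>
      ‖z.1 - η • U z.1 + σ • z.2‖ ^ 2) ((isoGaussian μ τ).prod (isoGaussian 0 1)) := by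
    refine (integrable_linear_growth_sq μ τ a (b * (1 + |σ|))).mono'
      (hmap.norm.pow_const 2).aestronglyMeasurable (ae_of_all _ fun z => ?_)
    rw [Real.norm_of_nonneg (sq_nonneg _)]
    refine (hle z).trans ?_
    have h1 : ‖z.1‖ + ‖σ • z.2‖ ≤ (1 + |σ|) * (‖z.1‖ + ‖z.2‖) := by
      rw [norm_smul, Real.norm_eq_abs]
      have : 0 ≤ |σ| * ‖z.1‖ := by positivity
      have := norm_nonneg z.2
      linarith
    rw [mul_assoc]
    gcongr
  have h2 : Integrable (fun x => ‖x‖ ^ 2) (nextLaw U μ η τ σ) := by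
    rw [nextLaw_eq_map hUc]
    exact (integrable_map_measure hsq hmap.aemeasurable).2 hint
  obtain ⟨hH, hlow, hup⟩ := hasShannonEntropy_of_bounded_density
    (f := fun y => ∫⁻ x, ENNReal.ofReal (transitionDensity U η σ y x) ∂(isoGaussian μ τ))
    ((continuous_transitionDensity hUc η σ).measurable.ennreal_ofReal.lintegral_prod_right')
    (nextLaw_eq_withDensity hUc μ η τ hσ)
    -- The common peak height of the mixed Gaussian densities, inherited by their average.
    (C := (2 * Real.pi * σ ^ 2) ^ (-(d : ℝ) / 2)) (by positivity)
    (fun y => by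
      refine (lintegral_mono fun x => ENNReal.ofReal_le_ofReal
        (isoGaussianDensity_le (x - η • U x) (pow_pos hσ 2) y)).trans_eq ?_
      simp) h2
  refine ⟨hH, ?_, fun hσ1 => hup.trans ?_⟩
  · rw [Real.log_rpow (by positivity)] at hlow
    linarith
  · gcongr
    rw [nextLaw_eq_map hUc, integral_map hmap.aemeasurable hsq]
    refine integral_mono hint (integrable_linear_growth_sq μ τ a b) fun z => (hle z).trans ?_
    have := norm_smul_le_of_mem_Ioc ⟨hσ, hσ1⟩ z.2
    gcongr

lemma tendsto_sq_mul_log_sq :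
    Tendsto (fun σ : ℝ => σ ^ 2 * Real.log (2 * Real.pi * σ ^ 2)) (𝓝[>] 0) (𝓝 0) := by
  have h1 : Tendsto (fun σ : ℝ => σ ^ 2) (𝓝[>] 0) (𝓝 0) := by
    refine tendsto_nhdsWithin_of_tendsto_nhds ?_
    simpa using (continuous_pow 2).tendsto (0 : ℝ)
  have h2 : Tendsto (fun σ : ℝ => Real.log σ * σ ^ (2 : ℝ)) (𝓝[>] 0) (𝓝 0) :=
    tendsto_log_mul_rpow_nhdsGT_zero two_pos
  have h3 := (h1.mul_const (Real.log (2 * Real.pi))).add (h2.const_mul 2)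
  rw [zero_mul, mul_zero, add_zero] at h3
  refine h3.congr' ?_
  filter_upwards [self_mem_nhdsWithin] with σ hσ
  have hσ : 0 < σ := hσ
  rw [Real.log_mul (x := 2 * Real.pi) (by positivity) (by positivity), Real.log_pow,
    Real.rpow_two]
  push_cast
  ring

/-- A squeeze: the lower entropy bound diverges at most logarithmically in σ, and the upper one is
constant for σ ≤ 1. -/
lemma tendsto_sq_mul_systemEntropy (hU : LipschitzWith K U) (μ : EuclideanSpace ℝ (Fin d))
    {η : ℝ} (hη : 0 ≤ η) (τ : ℝ) :
    Tendsto (fun σ : ℝ => σ ^ 2 * systemEntropy U μ η τ σ) (𝓝[>] 0) (𝓝 0) := by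
  obtain ⟨M, hM⟩ := hasShannonEntropy_nextLaw hU μ hη τ
  have h1 : Tendsto (fun σ : ℝ => σ ^ 2) (𝓝[>] 0) (𝓝 0) := by
    refine tendsto_nhdsWithin_of_tendsto_nhds ?_
    simpa using (continuous_pow 2).tendsto (0 : ℝ)
  have hlow := (tendsto_sq_mul_log_sq.const_mul ((d : ℝ) / 2)).sub
    (h1.mul_const (shannonEntropy (isoGaussian μ τ)))
  have hup := h1.mul_const (M - shannonEntropy (isoGaussian μ τ))
  rw [mul_zero, zero_mul, sub_zero] at hlow
  rw [zero_mul] at hup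
  refine tendsto_of_tendsto_of_tendsto_of_le_of_le' hlow hup ?_ ?_
  · filter_upwards [self_mem_nhdsWithin] with σ hσ
    have := mul_le_mul_of_nonneg_left (hM σ hσ).2.1 (sq_nonneg σ)
    rw [systemEntropy]
    linarith
  · filter_upwards [Ioc_mem_nhdsGT zero_lt_one] with σ hσ
    rw [systemEntropy]
    exact mul_le_mul_of_nonneg_left (sub_le_sub_right ((hM σ hσ.1).2.2 hσ.2) _) (sq_nonneg σ)

/-! ### The limits σ → 0 and τ → 0 of the bath term -/

/-- The small-noise limit of the scaled bath entropy production started from `x`. -/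
def smallNoiseBath (U : EuclideanSpace ℝ (Fin d) → EuclideanSpace ℝ (Fin d)) (η : ℝ)
    (x : EuclideanSpace ℝ (Fin d)) : ℝ :=
  ‖η • (U x + U (x - η • U x))‖ ^ 2 / 2

lemma continuous_smallNoiseBath (hU : Continuous U) (η : ℝ) :
    Continuous (smallNoiseBath U η) := by
  unfold smallNoiseBath
  fun_prop

lemma scaledBathEntropy_zero (η : ℝ)
    (z : EuclideanSpace ℝ (Fin d) × EuclideanSpace ℝ (Fin d)) :
    scaledBathEntropy U η 0 z = smallNoiseBath U η z.1 := by
  simp [scaledBathEntropy, smallNoiseBath]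

lemma tendsto_integral_scaledBathEntropy (hU : LipschitzWith K U)
    (μ : EuclideanSpace ℝ (Fin d)) {η : ℝ} (hη : 0 ≤ η) (τ : ℝ) :
    Tendsto (fun σ : ℝ =>
        ∫ z, scaledBathEntropy U η σ z ∂((isoGaussian μ τ).prod (isoGaussian 0 1)))
      (𝓝[>] 0) (𝓝 (∫ x, smallNoiseBath U η x ∂(isoGaussian μ τ))) := by
  obtain ⟨a, b, ha, hb, h⟩ := exists_linear_growth hU hη
  have hfst : ∫ x, smallNoiseBath U η x ∂(isoGaussian μ τ) =
      ∫ z, smallNoiseBath U η z.1 ∂((isoGaussian μ τ).prod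
        (isoGaussian (0 : EuclideanSpace ℝ (Fin d)) 1)) := by
    rw [integral_fun_fst (smallNoiseBath U η), probReal_univ, one_smul]
  rw [hfst]
  have hc := continuous_scaledBathEntropy hU.continuous η
  refine tendsto_integral_filter_of_dominated_convergence
    (fun z => (η * a + (η * b + 1) * (‖z.1‖ + ‖z.2‖)) ^ 2)
    (Eventually.of_forall fun σ => (hc.comp (Continuous.prodMk_right σ)).aestronglyMeasurable)
    ?_ (integrable_linear_growth_sq μ τ _ _) (ae_of_all _ fun z => ?_)
  · filter_upwards [Ioc_mem_nhdsGT zero_lt_one] with σ hσ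
    refine ae_of_all _ fun z =>
      (abs_scaledBathEntropy_le hη ha hb (fun x e => (h x e).2) σ z).trans ?_
    have := norm_smul_le_of_mem_Ioc hσ z.2
    gcongr
  · rw [← scaledBathEntropy_zero]
    exact ((hc.comp (Continuous.prodMk_left z)).tendsto (0 : ℝ)).mono_left nhdsWithin_le_nhds

lemma tendsto_integral_smallNoiseBath (hU : LipschitzWith K U)
    (μ : EuclideanSpace ℝ (Fin d)) {η : ℝ} (hη : 0 ≤ η) :
    Tendsto (fun τ : ℝ => ∫ x, smallNoiseBath U η x ∂(isoGaussian μ τ)) (𝓝[>] 0)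
      (𝓝 (smallNoiseBath U η μ)) := by
  obtain ⟨a, b, ha, hb, h⟩ := exists_linear_growth hU hη
  have hc := continuous_smallNoiseBath hU.continuous η
  -- Writing x = μ + √τ z fixes the law; for τ ≤ 1 the dominating function does not depend on τ.
  have hlim : Tendsto (fun τ : ℝ => ∫ z, smallNoiseBath U η (μ + √τ • z)
      ∂(isoGaussian (0 : EuclideanSpace ℝ (Fin d)) 1)) (𝓝[>] 0)
      (𝓝 (∫ _z, smallNoiseBath U η μ ∂(isoGaussian (0 : EuclideanSpace ℝ (Fin d)) 1))) := by
    refine tendsto_integral_filter_of_dominated_convergence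
      (fun z => (η * a + η * b * (‖μ‖ + ‖z‖)) ^ 2)
      (Eventually.of_forall fun τ => (hc.comp (by fun_prop)).aestronglyMeasurable) ?_ ?_
      (ae_of_all _ fun z => ?_)
    · filter_upwards [Ioc_mem_nhdsGT zero_lt_one] with τ hτ
      refine ae_of_all _ fun z => ?_
      have hz : ‖μ + √τ • z‖ ≤ ‖μ‖ + ‖z‖ :=
        (norm_add_le _ _).trans (add_le_add_right (norm_smul_le_of_mem_Ioc
          ⟨Real.sqrt_pos.2 hτ.1, Real.sqrt_le_one.2 hτ.2⟩ z) _)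
      have hx := (h (μ + √τ • z) 0).2
      rw [add_zero, norm_zero, add_zero] at hx
      have hs : ‖η • (U (μ + √τ • z) + U (μ + √τ • z - η • U (μ + √τ • z)))‖ ≤
          η * a + η * b * (‖μ‖ + ‖z‖) := by
        rw [norm_smul, Real.norm_of_nonneg hη, mul_assoc, ← mul_add]
        exact mul_le_mul_of_nonneg_left (hx.trans (by gcongr)) hη
      have hsq := pow_le_pow_left₀ (norm_nonneg _) hs 2
      rw [smallNoiseBath, Real.norm_of_nonneg (by positivity)]
      have := sq_nonneg (η * a + η * b * (‖μ‖ + ‖z‖))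
      linarith
    · have h2 : MemLp (fun z : EuclideanSpace ℝ (Fin d) => z) 2 (isoGaussian 0 1) :=
        IsGaussian.memLp_two_id
      exact ((memLp_const (η * a)).add
        (((memLp_const ‖μ‖).add h2.norm).const_mul (η * b))).integrable_sq
    · have hcz : Continuous fun τ : ℝ => smallNoiseBath U η (μ + √τ • z) :=
        hc.comp (by fun_prop)
      simpa using (hcz.tendsto 0).mono_left nhdsWithin_le_nhds
  rw [integral_const, probReal_univ, one_smul] at hlim
  refine hlim.congr' ?_
  filter_upwards [self_mem_nhdsWithin] with τ hτ
  rw [isoGaussian_eq_map μ (le_of_lt hτ), integral_map (by fun_prop) hc.aestronglyMeasurable]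

/-! ### Expansion in the step size -/

lemma smallNoiseBath_sub_isBigO (hU : LipschitzWith K U) (μ : EuclideanSpace ℝ (Fin d)) :
    (fun η : ℝ => smallNoiseBath U η μ - 8 * η * phiST U η μ) =O[𝓝[>] 0]
      (fun η : ℝ => η ^ 3) := by
  set c := ‖U μ‖ with hc
  -- The error is (η²/2)(s - 2c)(s + 2c): Lipschitz continuity bounds the first factor by Kcη, and η
  -- ≤ 1 bounds the second by 4c + Kc.
  refine IsBigO.of_bound (K * c * (4 * c + K * c) / 2) ?_
  filter_upwards [Ioc_mem_nhdsGT zero_lt_one] with η hη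
  have hη0 := hη.1.le
  set s := ‖U μ + U (μ - η • U μ)‖ with hs
  have hc0 : 0 ≤ c := norm_nonneg _
  have hK : (0 : ℝ) ≤ K := K.coe_nonneg
  have hdiff : |s - 2 * c| ≤ K * (η * c) := by
    have h1 : 2 * c = ‖U μ + U μ‖ := by rw [← two_smul ℝ (U μ), norm_smul, Real.norm_two]
    rw [h1]
    refine (abs_norm_sub_norm_le _ _).trans ?_
    rw [add_sub_add_left_eq_sub]
    refine (hU.norm_sub_le _ _).trans_eq ?_
    rw [sub_sub_cancel_left, norm_neg, norm_smul, Real.norm_of_nonneg hη0]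
  have hsum : |s + 2 * c| ≤ 4 * c + K * c := by
    have h2 : K * (η * c) ≤ K * c :=
      mul_le_mul_of_nonneg_left (mul_le_of_le_one_left hc0 hη.2) hK
    rw [abs_of_nonneg (by positivity)]
    linarith [(abs_le.1 hdiff).2]
  have heq : smallNoiseBath U η μ - 8 * η * phiST U η μ =
      η ^ 2 / 2 * ((s - 2 * c) * (s + 2 * c)) := by
    rw [smallNoiseBath, phiST, norm_smul, ← hs, ← hc, Real.norm_of_nonneg hη0]
    ring
  rw [heq, Real.norm_eq_abs, abs_mul, abs_mul, Real.norm_of_nonneg (by positivity),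
    abs_of_nonneg (by positivity : 0 ≤ η ^ 2 / 2)]
  calc η ^ 2 / 2 * (|s - 2 * c| * |s + 2 * c|)
      ≤ η ^ 2 / 2 * (K * (η * c) * (4 * c + K * c)) := by gcongr
    _ = _ := by ring

end EntropyProduction

end

theorem mainTheorem5 {d : ℕ} (U : EuclideanSpace ℝ (Fin d) → EuclideanSpace ℝ (Fin d))
    (K : NNReal) (hU : LipschitzWith K U) (μ : EuclideanSpace ℝ (Fin d)) :
    -- all the quantities are well defined
    (∀ η τ σ : ℝ, 0 < η → 0 < τ → 0 < σ →
      EntropyProduction.HasShannonEntropy (EntropyProduction.isoGaussian μ τ) ∧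
      EntropyProduction.HasShannonEntropy (EntropyProduction.nextLaw U μ η τ σ) ∧
      Integrable (EntropyProduction.totalEntropy U μ η τ σ)
        (EntropyProduction.jointLaw U μ η τ σ)) ∧
    -- both limits exist for every step size, and the iterated limit has the stated expansion
    ∃ (S : ℝ → ℝ → ℝ) (L : ℝ → ℝ),
      (∀ η τ : ℝ, 0 < η → 0 < τ →
        Tendsto (fun σ : ℝ => σ ^ 2 *
            ∫ z, EntropyProduction.totalEntropy U μ η τ σ z ∂(EntropyProduction.jointLaw U μ η τ σ))
          (𝓝[>] 0) (𝓝 (S η τ))) ∧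
      (∀ η : ℝ, 0 < η → Tendsto (fun τ : ℝ => S η τ) (𝓝[>] 0) (𝓝 (L η))) ∧
      (fun η : ℝ => L η - 8 * η * EntropyProduction.phiST U η μ) =O[𝓝[>] 0]
        (fun η : ℝ => η ^ 3) := by
  refine ⟨fun η τ σ hη hτ hσ => ⟨EntropyProduction.hasShannonEntropy_isoGaussian μ hτ, ?_,
      EntropyProduction.integrable_totalEntropy hU μ hη.le τ hσ⟩,
    fun η τ => ∫ x, EntropyProduction.smallNoiseBath U η x ∂(EntropyProduction.isoGaussian μ τ),
    fun η => EntropyProduction.smallNoiseBath U η μ, fun η τ hη _ => ?_,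
    fun η hη => EntropyProduction.tendsto_integral_smallNoiseBath hU μ hη.le,
    EntropyProduction.smallNoiseBath_sub_isBigO hU μ⟩
  · obtain ⟨M, hM⟩ := EntropyProduction.hasShannonEntropy_nextLaw hU μ hη.le τ
    exact (hM σ hσ).1
  · have h := (EntropyProduction.tendsto_integral_scaledBathEntropy hU μ hη.le τ).add
      (EntropyProduction.tendsto_sq_mul_systemEntropy hU μ hη.le τ)
    rw [add_zero] at h
    refine h.congr' ?_
    filter_upwards [self_mem_nhdsWithin] with σ hσ
    exact (EntropyProduction.sq_mul_integral_totalEntropy hU μ hη.le τ hσ).symm
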